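/- Let $d\ge 0$ and $n\ge 1$ be integers, and let $P_k=P_{d,k}$ denote the space of homogeneous polynomials of degree $k$ in $\mathbb{C}[z_1,\dots,z_d]$ (including $0$). For a polynomial $f=\sum_\alpha a_\alpha z^\alpha$ put $\|f\|_2=\big(\sum_\alpha |a_\alpha|^2\big)^{1/2}$ and $$\|f\|_{\mathrm{SA}}=\sup\{\|f(T_1,\dots,T_d)\| : T_1,\dots,T_d \text{ are pairwise commuting operators of norm} \le 1 \text{ on a complex Hilbert space}\}.$$ For $k,l\ge 0$ define $$\|p\|_{P_k\odot P_l}=\inf\Big\{\sum_{j=1}^m\|f_j\|_2\|g_j\|_2 : m\ge 0,\ f_j\in P_k,\ g_j\in P_l,\ p=\sum_{j=1}^m f_jg_j\Big\}\qquad(p\in P_{k+l}),$$ $$\|p\|_{Z\odot P_k\odot P_l}=\inf\Big\{\sum_{i=1}^d\|f_i\|_{P_k\odot P_l} : f_i\in P_{k+l},\ p=\sum_{i=1}^d z_if_i\Big\}\qquad(p\in P_{k+l+1}),$$ and, for $p\in P_n$, $$|||p|||_1=\max_{0\le k\le n}\|p\|_{P_k\odot P_{n-k}},\qquad |||p|||_2=\max_{0\le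 k\le n-1}\|p\|_{Z\odot P_k\odot P_{n-k-1}}.$$ Then for every $p\in P_n$, $$\|p\|_{\mathrm{SA}}\ \ge\ |||p|||_2\ \ge\ |||p|||_1 .$$ -/

import Mathlib

universe u

namespace SchurAgler

/-- The Hardy norm `‖p‖₂ = (∑_α |p_α|²)^{1/2}` of a polynomial `p = ∑_α p_α z^α`. -/
noncomputable def hardyNorm {d : ℕ} (p : MvPolynomial (Fin d) ℂ) : ℝ :=
  Real.sqrt (∑ α ∈ p.support, ‖p.coeff α‖ ^ 2)

/-- `p(T) = ∑_α p_α T_1^{α_1} ⋯ T_d^{α_d}`; the product is written in the order of the indices,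
which is immaterial for the commuting tuples to which it is applied. -/
noncomputable def polyEval {d : ℕ} {A : Type*} [Ring A] [Algebra ℂ A] (T : Fin d → A)
    (p : MvPolynomial (Fin d) ℂ) : A :=
  ∑ α ∈ p.support, p.coeff α • (List.ofFn fun i => T i ^ α i).prod

/-- All numbers `‖p(T)‖`, where `T` is a commuting `d`-tuple of contractions on a complex
Hilbert space. -/
def schurAglerValues {d : ℕ} (p : MvPolynomial (Fin d) ℂ) : Set ℝ :=
  {r : ℝ | ∃ (H : Type u) (_ : NormedAddCommGroup H) (_ : InnerProductSpace ℂ H)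
    (_ : CompleteSpace H) (T : Fin d → (H →L[ℂ] H)),
    (∀ i j, Commute (T i) (T j)) ∧ (∀ i, ‖T i‖ ≤ 1) ∧ r = ‖polyEval T p‖}

/-- The Schur--Agler norm of a polynomial. -/
noncomputable def schurAglerNorm {d : ℕ} (p : MvPolynomial (Fin d) ℂ) : ℝ :=
  sSup (schurAglerValues.{u} p)

/-- All sums `∑_j ‖f_j‖₂ ‖g_j‖₂` arising from finite decompositions `p = ∑_j f_j g_j` with
`f_j ∈ P_{d,k}` and `g_j ∈ P_{d,l}`. -/
def weakProductSums {d : ℕ} (k l : ℕ) (p : MvPolynomial (Fin d) ℂ) : Set ℝ :=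
  {r : ℝ | ∃ (m : ℕ) (f g : Fin m → MvPolynomial (Fin d) ℂ),
    (∀ j, (f j).IsHomogeneous k) ∧ (∀ j, (g j).IsHomogeneous l) ∧
    p = ∑ j, f j * g j ∧ r = ∑ j, hardyNorm (f j) * hardyNorm (g j)}

/-- The weak product norm of `P_{d,k} ⊙ P_{d,l}`, for `p ∈ P_{d,k+l}`. -/
noncomputable def weakProductNorm {d : ℕ} (k l : ℕ) (p : MvPolynomial (Fin d) ℂ) : ℝ :=
  sInf (weakProductSums k l p)

/-- All sums `∑_i ‖f_i‖_{P_{d,k} ⊙ P_{d,l}}` arising from `p = ∑_i z_i f_i` with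
`f_i ∈ P_{d,k+l}`. -/
def zWeakProductSums {d : ℕ} (k l : ℕ) (p : MvPolynomial (Fin d) ℂ) : Set ℝ :=
  {r : ℝ | ∃ f : Fin d → MvPolynomial (Fin d) ℂ,
    (∀ i, (f i).IsHomogeneous (k + l)) ∧
    p = ∑ i, MvPolynomial.X i * f i ∧ r = ∑ i, weakProductNorm k l (f i)}

/-- The weak product norm of `Z_d ⊙ P_{d,k} ⊙ P_{d,l}`, for `p ∈ P_{d,k+l+1}`. -/
noncomputable def zWeakProductNorm {d : ℕ} (k l : ℕ) (p : MvPolynomial (Fin d) ℂ) : ℝ :=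
  sInf (zWeakProductSums k l p)

/-- `|||p|||_1`, the maximum over `0 ≤ k ≤ n` of the norms of `P_{d,k} ⊙ P_{d,n-k}`,
for `p ∈ P_{d,n}`. -/
noncomputable def tripleNormOne {d : ℕ} (n : ℕ) (p : MvPolynomial (Fin d) ℂ) : ℝ :=
  (Finset.range (n + 1)).sup' Finset.nonempty_range_add_one
    fun k => weakProductNorm k (n - k) p

/-- `|||p|||_2`, the maximum over `0 ≤ k ≤ n - 1` of the norms of
`Z_d ⊙ P_{d,k} ⊙ P_{d,n-k-1}`, for `p ∈ P_{d,n}` and `n ≥ 1`. -/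
noncomputable def tripleNormTwo {d : ℕ} (n : ℕ) (hn : n ≠ 0) (p : MvPolynomial (Fin d) ℂ) : ℝ :=
  (Finset.range n).sup' (Finset.nonempty_range_iff.mpr hn)
    fun k => zWeakProductNorm k (n - k - 1) p

/-! The sets above are non-empty and bounded on the relevant side, so that the suprema and infima
are the true ones. -/

theorem schurAglerValues_nonempty {d : ℕ} (p : MvPolynomial (Fin d) ℂ) :
    (schurAglerValues.{u} p).Nonempty :=
  ⟨_, EuclideanSpace ℂ PEmpty.{u + 1}, inferInstance, inferInstance, inferInstance,
    fun _ => 0, fun _ _ => Commute.refl _, fun _ => by simp, rfl⟩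

theorem schurAglerValues_bddAbove {d : ℕ} (p : MvPolynomial (Fin d) ℂ) :
    BddAbove (schurAglerValues.{u} p) := by
  refine ⟨∑ α ∈ p.support, ‖p.coeff α‖, ?_⟩
  rintro r ⟨H, _, _, _, T, -, hT, rfl⟩
  refine (norm_sum_le _ _).trans (Finset.sum_le_sum fun α _ => ?_)
  rw [norm_smul]
  refine mul_le_of_le_one_right (norm_nonneg _) ?_
  have key : ∀ L : List (H →L[ℂ] H), (∀ S ∈ L, ‖S‖ ≤ 1) → ‖L.prod‖ ≤ 1 := by
    intro L
    induction L with
    | nil => intro _; exact ContinuousLinearMap.norm_id_le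
    | cons S L ih =>
      intro h
      rw [List.prod_cons]
      exact (norm_mul_le _ _).trans (mul_le_one₀ (h S (by simp)) (norm_nonneg _)
        (ih fun S' hS' => h S' (by simp [hS'])))
  refine key _ fun S hS => ?_
  obtain ⟨i, rfl⟩ := (List.mem_ofFn' _ _).mp hS
  rw [show (fun i => T i ^ α i) i = T i ^ α i from rfl, ← List.prod_replicate]
  refine key _ fun S' hS' => ?_
  rw [List.eq_of_mem_replicate hS']
  exact hT i

theorem hardyNorm_nonneg {d : ℕ} (p : MvPolynomial (Fin d) ℂ) : 0 ≤ hardyNorm p :=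
  Real.sqrt_nonneg _

theorem weakProductSums_bddBelow {d : ℕ} (k l : ℕ) (p : MvPolynomial (Fin d) ℂ) :
    BddBelow (weakProductSums k l p) := by
  refine ⟨0, ?_⟩
  rintro r ⟨m, f, g, -, -, -, rfl⟩
  exact Finset.sum_nonneg fun j _ => mul_nonneg (hardyNorm_nonneg _) (hardyNorm_nonneg _)

theorem weakProductNorm_nonneg {d : ℕ} (k l : ℕ) (p : MvPolynomial (Fin d) ℂ) :
    0 ≤ weakProductNorm k l p := by
  refine Real.sInf_nonneg ?_
  rintro r ⟨m, f, g, -, -, -, rfl⟩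
  exact Finset.sum_nonneg fun j _ => mul_nonneg (hardyNorm_nonneg _) (hardyNorm_nonneg _)

theorem zWeakProductSums_bddBelow {d : ℕ} (k l : ℕ) (p : MvPolynomial (Fin d) ℂ) :
    BddBelow (zWeakProductSums k l p) := by
  refine ⟨0, ?_⟩
  rintro r ⟨f, -, -, rfl⟩
  exact Finset.sum_nonneg fun i _ => weakProductNorm_nonneg _ _ _

/-- A multi-index of degree `k + l` is a sum of multi-indices of degrees `k` and `l`. -/
theorem exists_add_of_degree_eq {d : ℕ} (k l : ℕ) (α : Fin d →₀ ℕ) (hα : α.degree = k + l) :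
    ∃ β γ : Fin d →₀ ℕ, α = β + γ ∧ β.degree = k ∧ γ.degree = l := by
  obtain ⟨β, hle, hβ⟩ := Finsupp.exists_le_degree_eq α k (by omega)
  obtain ⟨γ, rfl⟩ := exists_add_of_le hle
  rw [map_add] at hα
  exact ⟨β, γ, rfl, hβ, by omega⟩

theorem weakProductSums_nonempty {d : ℕ} (k l : ℕ) (p : MvPolynomial (Fin d) ℂ)
    (hp : p.IsHomogeneous (k + l)) : (weakProductSums k l p).Nonempty := by
  have hdeg : ∀ α ∈ p.support, α.degree = k + l := fun α hα => by
    rw [Finsupp.degree_eq_weight_one]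
    exact hp (MvPolynomial.mem_support_iff.mp hα)
  choose! β γ hαβγ hβ hγ using
    fun α (hα : α ∈ p.support) => exists_add_of_degree_eq k l α (hdeg α hα)
  let e := p.support.equivFin.symm
  refine ⟨_, p.support.card, fun j => MvPolynomial.monomial (β (e j)) (p.coeff (e j)),
    fun j => MvPolynomial.monomial (γ (e j)) 1,
    fun j => MvPolynomial.isHomogeneous_monomial _ (hβ _ (e j).2),
    fun j => MvPolynomial.isHomogeneous_monomial _ (hγ _ (e j).2), ?_, rfl⟩
  simp only [MvPolynomial.monomial_mul, mul_one]
  rw [Equiv.sum_comp e fun α : p.support =>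
    MvPolynomial.monomial (β α + γ α) (p.coeff (α : Fin d →₀ ℕ))]
  conv_lhs => rw [p.as_sum, ← Finset.sum_coe_sort]
  exact Finset.sum_congr rfl fun α _ => by rw [← hαβγ _ α.2]

theorem zWeakProductSums_nonempty {d : ℕ} (k l : ℕ) (p : MvPolynomial (Fin d) ℂ)
    (hp : p.IsHomogeneous (k + l + 1)) : (zWeakProductSums k l p).Nonempty := by
  suffices h : ∃ f : Fin d → MvPolynomial (Fin d) ℂ,
      (∀ i, (f i).IsHomogeneous (k + l)) ∧ p = ∑ i, MvPolynomial.X i * f i by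
    obtain ⟨f, hf, hpf⟩ := h
    exact ⟨_, f, hf, hpf, rfl⟩
  have hdeg : ∀ α ∈ p.support, α.degree = 1 + (k + l) := fun α hα => by
    rw [Finsupp.degree_eq_weight_one, add_comm 1]
    exact hp (MvPolynomial.mem_support_iff.mp hα)
  have hex : ∀ α ∈ p.support, ∃ (i : Fin d) (γ : Fin d →₀ ℕ),
      α = Finsupp.single i 1 + γ ∧ γ.degree = k + l := by
    intro α hα
    have h := hdeg α hα
    have h0 : α ≠ 0 := by
      rintro rfl
      rw [map_zero] at h
      omega
    obtain ⟨i, hi⟩ := Finsupp.ne_iff.mp h0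
    obtain ⟨γ, hγ⟩ := exists_add_of_le (Finsupp.single_le_iff.mpr (Nat.one_le_iff_ne_zero.mpr hi))
    refine ⟨i, γ, hγ, ?_⟩
    rw [hγ, map_add, Finsupp.degree_single] at h
    omega
  have hterm : ∀ α ∈ p.support, ∃ f : Fin d → MvPolynomial (Fin d) ℂ,
      (∀ i, (f i).IsHomogeneous (k + l)) ∧
      MvPolynomial.monomial α (p.coeff α) = ∑ i, MvPolynomial.X i * f i := by
    intro α hα
    obtain ⟨i, γ, h1, h2⟩ := hex α hα
    refine ⟨Pi.single i (MvPolynomial.monomial γ (p.coeff α)), fun j => ?_, ?_⟩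
    · by_cases hj : j = i
      · subst hj
        simpa using MvPolynomial.isHomogeneous_monomial (p.coeff α) h2
      · simpa [hj] using MvPolynomial.isHomogeneous_zero (Fin d) ℂ (k + l)
    · rw [Finset.sum_eq_single i (fun j _ hj => by simp [hj]) (by simp), Pi.single_eq_same,
        MvPolynomial.X, MvPolynomial.monomial_mul, one_mul, ← h1]
  choose! F hF hFs using hterm
  refine ⟨fun i => ∑ α ∈ p.support, F α i,
    fun i => MvPolynomial.IsHomogeneous.sum _ _ _ fun α hα => hF α hα i, ?_⟩
  simp only [Finset.mul_sum]
  rw [Finset.sum_comm]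
  conv_lhs => rw [p.as_sum]
  exact Finset.sum_congr rfl hFs

end SchurAgler

namespace SchurAgler

open MvPolynomial

variable {d : ℕ}

/-! The second inequality holds because multiplication by `z_i` is isometric for the Hardy norm: in
a decomposition `p = ∑ z_i f_j g_j` the variable can be absorbed into either factor at no cost.

For the first, fix `k + l + 1 = n`. Hahn-Banach (`exists_dual_zWeakProduct`) gives a functional `φ`,
living in degree `n`, with `|φ(z_i f g)| ≤ ‖f‖₂ ‖g‖₂` and `|φ(p)|` at least the norm of `p`. From
`φ` one builds a map `V` (`modelMap`) into a finite-dimensional Hilbert space, listing the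
coefficients of `q` up to degree `k` and the numbers `φ(z^γ q)` for `|γ| ≤ l`. Multiplication by
`z_i` does not increase `‖V q‖` (`norm_modelMap_X_mul_le`): the layer of coefficients of degree `k`
is lost, and it pays for the new terms with `|γ| = l`. So the multiplications descend to commuting
contractions `T_i` on the range of `V`, with `p(T) V 1 = V p`. As `‖V 1‖ = 1`, this gives `|φ(p)| ≤
‖V p‖ ≤ ‖p(T)‖ ≤ ‖p‖_SA`. -/

/-! ### Hardy norm and lower bounds for infima. -/

theorem hardyNorm_sq_eq_sum (p : MvPolynomial (Fin d) ℂ) (s : Finset (Fin d →₀ ℕ))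
    (hs : p.support ⊆ s) : hardyNorm p ^ 2 = ∑ α ∈ s, ‖p.coeff α‖ ^ 2 := by
  rw [hardyNorm, Real.sq_sqrt (Finset.sum_nonneg fun _ _ => by positivity)]
  refine Finset.sum_subset hs fun α _ hα => ?_
  rw [notMem_support_iff.mp hα]
  simp

theorem hardyNorm_smul (c : ℂ) (p : MvPolynomial (Fin d) ℂ) :
    hardyNorm (c • p) = ‖c‖ * hardyNorm p := by
  rw [← sq_eq_sq₀ (hardyNorm_nonneg _) (mul_nonneg (norm_nonneg _) (hardyNorm_nonneg _)), mul_pow,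
    hardyNorm_sq_eq_sum (c • p) p.support support_smul, hardyNorm_sq_eq_sum p _ subset_rfl,
    Finset.mul_sum]
  exact Finset.sum_congr rfl fun α _ => by rw [coeff_smul, norm_smul, mul_pow]

theorem hardyNorm_X_mul (i : Fin d) (p : MvPolynomial (Fin d) ℂ) :
    hardyNorm (X i * p) = hardyNorm p := by
  rw [hardyNorm, hardyNorm, support_X_mul, Finset.sum_map]
  simp [coeff_X_mul]

/-- Two-fold lower bounds pass to the infima. -/
theorem le_sInf_add_sInf {A B : Set ℝ} {c : ℝ} (hA : A.Nonempty) (hB : B.Nonempty)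
    (h : ∀ a ∈ A, ∀ b ∈ B, c ≤ a + b) : c ≤ sInf A + sInf B := by
  rw [← sub_le_iff_le_add]
  refine le_csInf hA fun a ha => ?_
  rw [sub_le_comm]
  exact le_csInf hB fun b hb => by linarith [h a ha b hb]

/-- Scaled lower bounds pass to the infimum. -/
theorem le_mul_sInf {A : Set ℝ} {c r : ℝ} (hA : A.Nonempty) (hr : 0 ≤ r)
    (h : ∀ a ∈ A, c ≤ r * a) : c ≤ r * sInf A := by
  rcases hr.eq_or_lt with rfl | hr
  · obtain ⟨a, ha⟩ := hA
    simpa using h a ha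
  · rw [← div_le_iff₀' hr]
    exact le_csInf hA fun a ha => (div_le_iff₀' hr).mpr (h a ha)

/-! ### Weak product norms and the comparison of the two triple norms. -/

theorem weakProductNorm_zero (k l : ℕ) :
    weakProductNorm k l (0 : MvPolynomial (Fin d) ℂ) = 0 :=
  le_antisymm (csInf_le (weakProductSums_bddBelow _ _ _)
    ⟨0, Fin.elim0, Fin.elim0, fun j => j.elim0, fun j => j.elim0, by simp, by simp⟩)
    (weakProductNorm_nonneg _ _ _)

theorem weakProductNorm_add_le {k l : ℕ} {p q : MvPolynomial (Fin d) ℂ}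
    (hp : p.IsHomogeneous (k + l)) (hq : q.IsHomogeneous (k + l)) :
    weakProductNorm k l (p + q) ≤ weakProductNorm k l p + weakProductNorm k l q := by
  refine le_sInf_add_sInf (weakProductSums_nonempty k l p hp) (weakProductSums_nonempty k l q hq) ?_
  rintro _ ⟨m, f, g, hf, hg, rfl, rfl⟩ _ ⟨m', f', g', hf', hg', rfl, rfl⟩
  refine csInf_le (weakProductSums_bddBelow _ _ _)
    ⟨m + m', Fin.append f f', Fin.append g g', ?_, ?_, ?_, ?_⟩
  · exact Fin.addCases (by simpa using hf) (by simpa using hf')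
  · exact Fin.addCases (by simpa using hg) (by simpa using hg')
  · simp [Fin.sum_univ_add]
  · simp [Fin.sum_univ_add]

theorem weakProductNorm_sum_le {ι : Type*} (s : Finset ι) {k l : ℕ}
    {p : ι → MvPolynomial (Fin d) ℂ} (hp : ∀ i ∈ s, (p i).IsHomogeneous (k + l)) :
    weakProductNorm k l (∑ i ∈ s, p i) ≤ ∑ i ∈ s, weakProductNorm k l (p i) :=
  Finset.le_sum_of_subadditive_on_pred (weakProductNorm k l) (fun q => q.IsHomogeneous (k + l))
    (weakProductNorm_zero k l).le (fun _ _ => weakProductNorm_add_le)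
    (fun _ _ => IsHomogeneous.add) p hp

theorem weakProductNorm_smul_le {k l : ℕ} {p : MvPolynomial (Fin d) ℂ}
    (hp : p.IsHomogeneous (k + l)) (c : ℂ) :
    weakProductNorm k l (c • p) ≤ ‖c‖ * weakProductNorm k l p := by
  refine le_mul_sInf (weakProductSums_nonempty k l p hp) (norm_nonneg _) ?_
  rintro _ ⟨m, f, g, hf, hg, rfl, rfl⟩
  refine csInf_le (weakProductSums_bddBelow _ _ _) ⟨m, fun j => c • f j, g,
    fun j => (homogeneousSubmodule (Fin d) ℂ k).smul_mem c (hf j), hg, ?_, ?_⟩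
  · simp [Finset.smul_sum]
  · simp [Finset.mul_sum, hardyNorm_smul, mul_assoc]

theorem weakProductNorm_mul_le {k l : ℕ} {f g : MvPolynomial (Fin d) ℂ}
    (hf : f.IsHomogeneous k) (hg : g.IsHomogeneous l) :
    weakProductNorm k l (f * g) ≤ hardyNorm f * hardyNorm g :=
  csInf_le (weakProductSums_bddBelow _ _ _)
    ⟨1, fun _ => f, fun _ => g, fun _ => hf, fun _ => hg, by simp, by simp⟩

/-- Each `g_j` in a decomposition of `p` may be replaced by `z_i g_j`, which has the same Hardy
norm. -/
theorem weakProductNorm_X_mul_le_right {k l : ℕ} {p : MvPolynomial (Fin d) ℂ}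
    (hp : p.IsHomogeneous (k + l)) (i : Fin d) :
    weakProductNorm k (l + 1) (X i * p) ≤ weakProductNorm k l p := by
  refine le_csInf (weakProductSums_nonempty k l p hp) ?_
  rintro _ ⟨m, f, g, hf, hg, rfl, rfl⟩
  refine csInf_le (weakProductSums_bddBelow _ _ _) ⟨m, f, fun j => X i * g j, hf,
    fun j => by simpa [add_comm] using (isHomogeneous_X ℂ i).mul (hg j), ?_, ?_⟩
  · rw [Finset.mul_sum]
    exact Finset.sum_congr rfl fun j _ => mul_left_comm _ _ _
  · simp [hardyNorm_X_mul]

theorem weakProductNorm_X_mul_le_left {k l : ℕ} {p : MvPolynomial (Fin d) ℂ}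
    (hp : p.IsHomogeneous (k + l)) (i : Fin d) :
    weakProductNorm (k + 1) l (X i * p) ≤ weakProductNorm k l p := by
  refine le_csInf (weakProductSums_nonempty k l p hp) ?_
  rintro _ ⟨m, f, g, hf, hg, rfl, rfl⟩
  refine csInf_le (weakProductSums_bddBelow _ _ _) ⟨m, fun j => X i * f j, g,
    fun j => by simpa [add_comm] using (isHomogeneous_X ℂ i).mul (hf j), hg, ?_, ?_⟩
  · rw [Finset.mul_sum]
    exact Finset.sum_congr rfl fun j _ => (mul_assoc _ _ _).symm
  · simp [hardyNorm_X_mul]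

theorem weakProductNorm_le_zWeakProductNorm_right {k l : ℕ} {p : MvPolynomial (Fin d) ℂ}
    (hp : p.IsHomogeneous (k + l + 1)) :
    weakProductNorm k (l + 1) p ≤ zWeakProductNorm k l p := by
  refine le_csInf (zWeakProductSums_nonempty k l p hp) ?_
  rintro _ ⟨f, hf, rfl, rfl⟩
  refine (weakProductNorm_sum_le _ fun i _ => ?_).trans
    (Finset.sum_le_sum fun i _ => weakProductNorm_X_mul_le_right (hf i) i)
  convert (isHomogeneous_X ℂ i).mul (hf i) using 1
  omega

theorem weakProductNorm_le_zWeakProductNorm_left {k l : ℕ} {p : MvPolynomial (Fin d) ℂ}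
    (hp : p.IsHomogeneous (k + l + 1)) :
    weakProductNorm (k + 1) l p ≤ zWeakProductNorm k l p := by
  refine le_csInf (zWeakProductSums_nonempty k l p hp) ?_
  rintro _ ⟨f, hf, rfl, rfl⟩
  refine (weakProductNorm_sum_le _ fun i _ => ?_).trans
    (Finset.sum_le_sum fun i _ => weakProductNorm_X_mul_le_left (hf i) i)
  convert (isHomogeneous_X ℂ i).mul (hf i) using 1
  omega

theorem tripleNormOne_le_tripleNormTwo {n : ℕ} (hn : n ≠ 0) {p : MvPolynomial (Fin d) ℂ}
    (hp : p.IsHomogeneous n) : tripleNormOne n p ≤ tripleNormTwo n hn p := by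
  refine Finset.sup'_le _ _ fun k hk => ?_
  rw [Finset.mem_range] at hk
  -- For `k < n` the variable goes into the right factor. For `k = n` that factor has degree `0`, so
  -- the variable goes into the left one.
  rcases Nat.lt_succ_iff_lt_or_eq.mp hk with hkn | rfl
  · refine le_trans ?_ (Finset.le_sup' (fun k => zWeakProductNorm k (n - k - 1) p)
      (Finset.mem_range.mpr hkn))
    obtain ⟨l, rfl⟩ := Nat.exists_eq_add_of_lt hkn
    have h1 : k + l + 1 - k = l + 1 := by omega
    simpa [h1] using weakProductNorm_le_zWeakProductNorm_right hp
  · obtain ⟨k, rfl⟩ := Nat.exists_eq_succ_of_ne_zero hn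
    refine le_trans ?_ (Finset.le_sup' (fun j => zWeakProductNorm j (k.succ - j - 1) p)
      (Finset.self_mem_range_succ k))
    simpa using weakProductNorm_le_zWeakProductNorm_left (k := k) (l := 0) hp

/-! ### The seminorm on `Z ⊙ P_k ⊙ P_l` and its duality. -/

theorem zWeakProductNorm_nonneg (k l : ℕ) (p : MvPolynomial (Fin d) ℂ) :
    0 ≤ zWeakProductNorm k l p := by
  refine Real.sInf_nonneg ?_
  rintro r ⟨f, -, -, rfl⟩
  exact Finset.sum_nonneg fun i _ => weakProductNorm_nonneg _ _ _

theorem zWeakProductNorm_add_le {k l : ℕ} {p q : MvPolynomial (Fin d) ℂ}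
    (hp : p.IsHomogeneous (k + l + 1)) (hq : q.IsHomogeneous (k + l + 1)) :
    zWeakProductNorm k l (p + q) ≤ zWeakProductNorm k l p + zWeakProductNorm k l q := by
  refine le_sInf_add_sInf (zWeakProductSums_nonempty k l p hp)
    (zWeakProductSums_nonempty k l q hq) ?_
  rintro _ ⟨f, hf, rfl, rfl⟩ _ ⟨g, hg, rfl, rfl⟩
  refine (csInf_le (zWeakProductSums_bddBelow _ _ _)
    ⟨fun i => f i + g i, fun i => (hf i).add (hg i), ?_, rfl⟩).trans ?_
  · simp [mul_add, Finset.sum_add_distrib]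
  · rw [← Finset.sum_add_distrib]
    exact Finset.sum_le_sum fun i _ => weakProductNorm_add_le (hf i) (hg i)

theorem zWeakProductNorm_smul_le {k l : ℕ} {p : MvPolynomial (Fin d) ℂ}
    (hp : p.IsHomogeneous (k + l + 1)) (c : ℂ) :
    zWeakProductNorm k l (c • p) ≤ ‖c‖ * zWeakProductNorm k l p := by
  refine le_mul_sInf (zWeakProductSums_nonempty k l p hp) (norm_nonneg _) ?_
  rintro _ ⟨f, hf, rfl, rfl⟩
  refine (csInf_le (zWeakProductSums_bddBelow _ _ _) ⟨fun i => c • f i,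
    fun i => (homogeneousSubmodule (Fin d) ℂ _).smul_mem c (hf i), ?_, rfl⟩).trans ?_
  · simp [Finset.smul_sum]
  · rw [Finset.mul_sum]
    exact Finset.sum_le_sum fun i _ => weakProductNorm_smul_le (hf i) c

theorem zWeakProductNorm_X_mul_mul_le {k l : ℕ} {f g : MvPolynomial (Fin d) ℂ}
    (hf : f.IsHomogeneous k) (hg : g.IsHomogeneous l) (i : Fin d) :
    zWeakProductNorm k l (X i * (f * g)) ≤ hardyNorm f * hardyNorm g := by
  refine (csInf_le (zWeakProductSums_bddBelow _ _ _)
    ⟨Pi.single i (f * g), fun j => ?_, ?_, rfl⟩).trans ?_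
  · by_cases hj : j = i
    · subst hj
      simpa using hf.mul hg
    · simpa [hj] using isHomogeneous_zero (Fin d) ℂ (k + l)
  · rw [Finset.sum_eq_single i (fun j _ hj => by simp [hj]) (by simp), Pi.single_eq_same]
  · rw [Finset.sum_eq_single i (fun j _ hj => by simp [hj, weakProductNorm_zero]) (by simp),
      Pi.single_eq_same]
    exact weakProductNorm_mul_le hf hg

/-- A polynomial is normed by a functional of norm at most one on `Z_d ⊙ P_{d,k} ⊙ P_{d,l}`. -/
theorem exists_dual_zWeakProduct (k l : ℕ) (p : MvPolynomial (Fin d) ℂ)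
    (hp : p.IsHomogeneous (k + l + 1)) :
    ∃ φ : MvPolynomial (Fin d) ℂ →ₗ[ℂ] ℂ,
      (∀ q, φ (homogeneousComponent (k + l + 1) q) = φ q) ∧
      (∀ (i : Fin d) (f g : MvPolynomial (Fin d) ℂ), f.IsHomogeneous k → g.IsHomogeneous l →
        ‖φ (X i * (f * g))‖ ≤ hardyNorm f * hardyNorm g) ∧
      zWeakProductNorm k l p ≤ ‖φ p‖ := by
  set n := k + l + 1 with hn
  -- Projecting to degree `n` makes the norm a sublinear functional on all polynomials, as
  -- Hahn-Banach needs.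
  let N : MvPolynomial (Fin d) ℂ → ℝ := fun q => zWeakProductNorm k l (homogeneousComponent n q)
  have hNp : N p = zWeakProductNorm k l p := by
    simp only [N]
    rw [homogeneousComponent_of_mem hp, if_pos rfl]
  -- If the norm vanishes, `φ = 0` serves; otherwise `p ≠ 0`, so a functional can be prescribed on
  -- its real span.
  rcases eq_or_ne (zWeakProductNorm k l p) 0 with h0 | h0
  · refine ⟨0, by simp, fun i f g _ _ => ?_, by simp [h0]⟩
    simpa using mul_nonneg (hardyNorm_nonneg f) (hardyNorm_nonneg g)
  have hsmul_le : ∀ (c : ℝ) (q : MvPolynomial (Fin d) ℂ), 0 ≤ c → N (c • q) ≤ c * N q := by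
    intro c q hc
    have h := zWeakProductNorm_smul_le (homogeneousComponent_isHomogeneous n q) (c : ℂ)
    rw [Complex.norm_of_nonneg hc] at h
    simpa only [N, ← map_smul, Complex.coe_smul] using h
  have hsmul : ∀ c : ℝ, 0 < c → ∀ q, N (c • q) = c * N q := by
    intro c hc q
    refine le_antisymm (hsmul_le c q hc.le) ?_
    have h := hsmul_le c⁻¹ (c • q) (inv_nonneg.mpr hc.le)
    rwa [inv_smul_smul₀ hc.ne', ← div_eq_inv_mul, le_div_iff₀' hc] at h
  have hadd : ∀ q r, N (q + r) ≤ N q + N r := fun q r => by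
    simp only [N, map_add]
    exact zWeakProductNorm_add_le (homogeneousComponent_isHomogeneous n q)
      (homogeneousComponent_isHomogeneous n r)
  have hN0 : N 0 ≤ 0 := by
    have h := hsmul_le 0 0 le_rfl
    rwa [zero_smul, zero_mul] at h
  have hp0 : p ≠ 0 := by
    rintro rfl
    exact h0 (le_antisymm (hNp ▸ hN0) (zWeakProductNorm_nonneg _ _ _))
  obtain ⟨g, hg, hgN⟩ := exists_extension_of_le_sublinear
    (LinearPMap.mkSpanSingleton (σ := RingHom.id ℝ) p (zWeakProductNorm k l p) hp0)
    N hsmul hadd (by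
      rintro ⟨x, hx⟩
      obtain ⟨t, rfl⟩ := Submodule.mem_span_singleton.mp hx
      refine (LinearPMap.mkSpanSingleton'_apply (σ := RingHom.id ℝ) _ _ _ t hx).trans_le ?_
      simp only [RingHom.id_apply, smul_eq_mul]
      rcases lt_trichotomy t 0 with ht | rfl | ht
      · exact (mul_nonpos_of_nonpos_of_nonneg ht.le (zWeakProductNorm_nonneg _ _ _)).trans
          (zWeakProductNorm_nonneg _ _ _)
      · simpa using zWeakProductNorm_nonneg _ _ _
      · rw [hsmul t ht, hNp])
  have hgp : g p = zWeakProductNorm k l p := by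
    have h := hg ⟨p, Submodule.mem_span_singleton.mpr ⟨1, one_smul _ _⟩⟩
    exact h.trans (LinearPMap.mkSpanSingleton_apply ℝ ℝ hp0 _)
  let ψ : MvPolynomial (Fin d) ℂ →ₗ[ℂ] ℂ := Module.Dual.extendRCLike g
  refine ⟨ψ ∘ₗ homogeneousComponent n, fun q => ?_, fun i f h hf hh => ?_, ?_⟩
  · simp only [LinearMap.comp_apply]
    rw [homogeneousComponent_of_mem (homogeneousComponent_isHomogeneous n q), if_pos rfl]
  · have hX : ∀ c : ℂ, (c • (X i * (f * h)) : MvPolynomial (Fin d) ℂ).IsHomogeneous n := fun c => by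
      have h1 := (isHomogeneous_X ℂ i).mul (hf.mul hh)
      rw [add_comm] at h1
      exact (homogeneousSubmodule (Fin d) ℂ n).smul_mem c h1
    rw [LinearMap.comp_apply, homogeneousComponent_of_mem (by simpa using hX 1), if_pos rfl]
    set z := ψ (X i * (f * h)) with hz
    rcases (norm_nonneg z).eq_or_lt with hz0 | hz0
    · rw [← hz0]
      exact mul_nonneg (hardyNorm_nonneg f) (hardyNorm_nonneg h)
    -- Rotating by `star z` turns the one-sided real bound `g ≤ N` into `|z|² ≤ |z| ‖f‖₂ ‖h‖₂`.
    have h1 : ‖z‖ ^ 2 = g (star z • (X i * (f * h))) :=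
      Module.Dual.norm_extendRCLike_apply_sq (𝕜 := ℂ) g (X i * (f * h))
    have h2 := hgN (star z • (X i * (f * h)))
    simp only [N] at h2
    rw [homogeneousComponent_of_mem (hX _), if_pos rfl, ← h1, ← mul_smul_comm,
      ← smul_mul_assoc] at h2
    have h3 := h2.trans (zWeakProductNorm_X_mul_mul_le
      ((homogeneousSubmodule (Fin d) ℂ k).smul_mem (star z) hf) hh i)
    rw [hardyNorm_smul, norm_star, sq, mul_assoc] at h3
    exact le_of_mul_le_mul_left h3 hz0
  · rw [LinearMap.comp_apply, homogeneousComponent_of_mem hp, if_pos rfl, ← hgp]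
    have h : (ψ p).re = g p := Module.Dual.re_extendRCLike_apply (𝕜 := ℂ) g p
    rw [← h]
    exact Complex.re_le_norm _

/-! ### Commuting contractions from a Hilbert space seminorm. -/

theorem norm_polyEval_le_schurAglerNorm {H : Type u} [NormedAddCommGroup H]
    [InnerProductSpace ℂ H] [CompleteSpace H] (T : Fin d → (H →L[ℂ] H))
    (hT : ∀ i j, Commute (T i) (T j)) (hT1 : ∀ i, ‖T i‖ ≤ 1) (p : MvPolynomial (Fin d) ℂ) :
    ‖polyEval T p‖ ≤ schurAglerNorm.{u} p :=
  le_csSup (schurAglerValues_bddAbove p) 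
    ⟨H, inferInstance, inferInstance, inferInstance, T, hT, hT1, rfl⟩

/-- A linear map that intertwines the multiplications by the variables with operators intertwines
the polynomial calculi. -/
theorem polyEval_apply_of_intertwines {H : Type*} [NormedAddCommGroup H] [InnerProductSpace ℂ H]
    (T : Fin d → (H →L[ℂ] H)) (V : MvPolynomial (Fin d) ℂ →ₗ[ℂ] H)
    (hV : ∀ i q, T i (V q) = V (X i * q)) (p : MvPolynomial (Fin d) ℂ) :
    polyEval T p (V 1) = V p := by
  have hpow : ∀ i m q, (T i ^ m) (V q) = V (X i ^ m * q) := by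
    intro i m
    induction m with
    | zero => simp
    | succ m ih =>
      intro q
      rw [pow_succ, mul_apply_eq_comp, hV, ih, pow_succ, mul_assoc]
  have hlist : ∀ (α : Fin d →₀ ℕ) (L : List (Fin d)),
      (L.map fun i => T i ^ α i).prod (V 1) =
        V (L.map fun i => (X i : MvPolynomial (Fin d) ℂ) ^ α i).prod := by
    intro α L
    induction L with
    | nil => simp
    | cons i L ih => rw [List.map_cons, List.prod_cons, mul_apply_eq_comp, ih, hpow,
        List.map_cons, List.prod_cons]
  conv_rhs => rw [p.as_sum]
  rw [polyEval, sum_apply, map_sum]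
  refine Finset.sum_congr rfl fun α _ => ?_
  rw [smul_apply, List.ofFn_eq_map, hlist, ← map_smul, ← List.ofFn_eq_map,
    List.prod_ofFn, monomial_eq, Finsupp.prod_fintype _ _ (by simp), smul_eq_C_mul]

/-- A seminorm induced by a map of the polynomials into a Hilbert space for which the
multiplications by the variables are contractive is dominated by the Schur--Agler norm. -/
theorem norm_apply_le_schurAglerNorm {H : Type u} [NormedAddCommGroup H]
    [InnerProductSpace ℂ H] [FiniteDimensional ℂ H] (V : MvPolynomial (Fin d) ℂ →ₗ[ℂ] H)
    (hV : ∀ i q, ‖V (X i * q)‖ ≤ ‖V q‖) (p : MvPolynomial (Fin d) ℂ) :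
    ‖V p‖ ≤ schurAglerNorm.{u} p * ‖V 1‖ := by
  let M : Fin d → (MvPolynomial (Fin d) ℂ →ₗ[ℂ] MvPolynomial (Fin d) ℂ) :=
    fun i => LinearMap.mulLeft ℂ (X i)
  -- Contractivity makes the kernel of `V` invariant, so multiplication by `z_i` descends to the
  -- range of `V`.
  have hker : ∀ i, V.ker ≤ (V.rangeRestrict ∘ₗ M i).ker := by
    intro i q hq
    rw [LinearMap.mem_ker] at hq ⊢
    refine Subtype.ext (norm_le_zero_iff.mp ?_)
    have h := hV i q
    rw [hq, norm_zero] at h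
    exact h
  let S : Fin d → (V.range →ₗ[ℂ] V.range) := fun i =>
    V.ker.liftQ (V.rangeRestrict ∘ₗ M i) (hker i) ∘ₗ V.quotKerEquivRange.symm.toLinearMap
  have hS : ∀ i q, S i (V.rangeRestrict q) = V.rangeRestrict (X i * q) := by
    intro i q
    have h : V.quotKerEquivRange.symm (V.rangeRestrict q) = V.ker.mkQ q :=
      V.quotKerEquivRange_symm_apply_image q _
    simp only [S, LinearMap.comp_apply, LinearEquiv.coe_coe, h]
    rfl
  have hsurj : ∀ x : V.range, ∃ q, V.rangeRestrict q = x := V.surjective_rangeRestrict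
  have hbound : ∀ i x, ‖S i x‖ ≤ 1 * ‖x‖ := by
    intro i x
    obtain ⟨q, rfl⟩ := hsurj x
    rw [hS, one_mul]
    exact hV i q
  let T : Fin d → (V.range →L[ℂ] V.range) := fun i => (S i).mkContinuous 1 (hbound i)
  have hT : ∀ i q, T i (V.rangeRestrict q) = V.rangeRestrict (X i * q) := hS
  have hcomm : ∀ i j, Commute (T i) (T j) := by
    intro i j
    refine ContinuousLinearMap.ext fun x => ?_
    obtain ⟨q, rfl⟩ := hsurj x
    rw [mul_apply_eq_comp, mul_apply_eq_comp, hT, hT, hT, hT,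
      mul_left_comm]
  have h1 : ‖polyEval T p (V.rangeRestrict 1)‖ ≤ schurAglerNorm.{u} p * ‖V.rangeRestrict 1‖ :=
    (ContinuousLinearMap.le_opNorm _ _).trans (mul_le_mul_of_nonneg_right
      (norm_polyEval_le_schurAglerNorm T hcomm
        (fun i => (S i).mkContinuous_norm_le zero_le_one (hbound i)) p) (norm_nonneg _))
  rwa [polyEval_apply_of_intertwines T V.rangeRestrict hT] at h1

/-! ### The model space attached to a functional. -/

/-- The multi-indices of degree at most `m`. -/
noncomputable def degreeLE (d m : ℕ) : Finset (Fin d →₀ ℕ) :=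
  (Finsupp.finite_of_degree_le m).toFinset

theorem mem_degreeLE {m : ℕ} {α : Fin d →₀ ℕ} : α ∈ degreeLE d m ↔ α.degree ≤ m := by
  simp [degreeLE]

/-- The map `q ↦ ((q_β)_{|β| ≤ k}, (φ(z^γ q))_{|γ| ≤ l})`. -/
noncomputable def modelMap (k l : ℕ) (φ : MvPolynomial (Fin d) ℂ →ₗ[ℂ] ℂ) :
    MvPolynomial (Fin d) ℂ →ₗ[ℂ] EuclideanSpace ℂ (ULift.{u} (degreeLE d k ⊕ degreeLE d l)) :=
  (WithLp.linearEquiv 2 ℂ _).symm.toLinearMap ∘ₗ LinearMap.pi fun x =>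
    Sum.elim (fun β : degreeLE d k => lcoeff ℂ (β : Fin d →₀ ℕ))
      (fun γ : degreeLE d l => φ ∘ₗ LinearMap.mulLeft ℂ (monomial (γ : Fin d →₀ ℕ) 1)) x.down

theorem norm_modelMap_sq (k l : ℕ) (φ : MvPolynomial (Fin d) ℂ →ₗ[ℂ] ℂ)
    (q : MvPolynomial (Fin d) ℂ) :
    ‖modelMap.{u} k l φ q‖ ^ 2 = ∑ β ∈ degreeLE d k, ‖q.coeff β‖ ^ 2 +
      ∑ γ ∈ degreeLE d l, ‖φ (monomial γ 1 * q)‖ ^ 2 := by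
  rw [EuclideanSpace.norm_sq_eq, ← Equiv.ulift.symm.sum_comp, Fintype.sum_sum_type,
    ← Finset.sum_coe_sort (degreeLE d k), ← Finset.sum_coe_sort (degreeLE d l)]
  rfl

/-- As `φ` sees only degree `k + l + 1`, only the part of `q` of degree `k` contributes. -/
theorem apply_monomial_mul_X_mul {k l : ℕ} {φ : MvPolynomial (Fin d) ℂ →ₗ[ℂ] ℂ}
    (hφ : ∀ q, φ (homogeneousComponent (k + l + 1) q) = φ q) {γ : Fin d →₀ ℕ}
    (hγ : γ.degree = l) (i : Fin d) (q : MvPolynomial (Fin d) ℂ) :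
    φ (monomial γ 1 * (X i * q)) =
      φ (X i * (homogeneousComponent k q * monomial γ 1)) := by
  induction q using MvPolynomial.induction_on' with
  | monomial β c =>
    have h1 : (monomial β c).IsHomogeneous β.degree := isHomogeneous_monomial c rfl
    have h2 : (monomial γ 1 * (X i * monomial β c)).IsHomogeneous (l + (1 + β.degree)) :=
      (isHomogeneous_monomial 1 hγ).mul ((isHomogeneous_X ℂ i).mul h1)
    rw [← hφ, homogeneousComponent_of_mem h2, homogeneousComponent_of_mem h1]
    by_cases hk : k = β.degree
    · rw [if_pos (by omega), if_pos hk]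
      congr 1
      ring
    · rw [if_neg (by omega), if_neg hk]
      simp
  | add p q hp hq => simp only [mul_add, map_add, add_mul, hp, hq]

/-- Self-duality of `ℓ²`: test the bound on the `g` whose coefficients are the conjugates of the
values `φ(z_i f z^γ)`, then cancel one factor `‖g‖₂`. -/
theorem sum_norm_sq_apply_le {k l : ℕ} {φ : MvPolynomial (Fin d) ℂ →ₗ[ℂ] ℂ} (i : Fin d)
    (hφ : ∀ f g : MvPolynomial (Fin d) ℂ, f.IsHomogeneous k → g.IsHomogeneous l →
      ‖φ (X i * (f * g))‖ ≤ hardyNorm f * hardyNorm g)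
    {f : MvPolynomial (Fin d) ℂ} (hf : f.IsHomogeneous k) (s : Finset (Fin d →₀ ℕ))
    (hs : ∀ γ ∈ s, γ.degree = l) :
    ∑ γ ∈ s, ‖φ (X i * (f * monomial γ 1))‖ ^ 2 ≤ hardyNorm f ^ 2 := by
  set c : (Fin d →₀ ℕ) → ℂ := fun γ => φ (X i * (f * monomial γ 1)) with hc
  set g : MvPolynomial (Fin d) ℂ := ∑ γ ∈ s, monomial γ (star (c γ)) with hg
  have hcoeff : ∀ α, g.coeff α = if α ∈ s then star (c α) else 0 := fun α => by
    simp [hg, coeff_sum, coeff_monomial]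
  have hgh : g.IsHomogeneous l :=
    IsHomogeneous.sum _ _ _ fun γ hγ => isHomogeneous_monomial _ (hs γ hγ)
  have hgn : hardyNorm g ^ 2 = ∑ γ ∈ s, ‖c γ‖ ^ 2 := by
    rw [hardyNorm_sq_eq_sum g s fun α hα => by
      by_contra h
      rw [mem_support_iff, hcoeff, if_neg h] at hα
      exact hα rfl]
    exact Finset.sum_congr rfl fun γ hγ => by rw [hcoeff, if_pos hγ, norm_star]
  have hφg : φ (X i * (f * g)) = ((hardyNorm g ^ 2 : ℝ) : ℂ) := by
    rw [hgn, hg, Finset.mul_sum, Finset.mul_sum, map_sum, Complex.ofReal_sum]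
    refine Finset.sum_congr rfl fun γ _ => ?_
    have h : monomial γ (star (c γ)) = star (c γ) • (monomial γ 1 : MvPolynomial (Fin d) ℂ) := by
      simp [smul_monomial]
    rw [h, mul_smul_comm, mul_smul_comm, map_smul, smul_eq_mul, mul_comm]
    simpa using Complex.mul_conj' (c γ)
  have h := hφ f g hf hgh
  rw [hφg, Complex.norm_of_nonneg (sq_nonneg _)] at h
  rw [← hgn]
  refine pow_le_pow_left₀ (hardyNorm_nonneg g) ?_ 2
  rcases (hardyNorm_nonneg g).eq_or_lt with h0 | h0
  · rw [← h0]
    exact hardyNorm_nonneg f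
  · rw [sq] at h
    exact le_of_mul_le_mul_right h h0

theorem norm_modelMap_X_mul_le {k l : ℕ} {φ : MvPolynomial (Fin d) ℂ →ₗ[ℂ] ℂ}
    (hφn : ∀ q, φ (homogeneousComponent (k + l + 1) q) = φ q)
    (hφ : ∀ (i : Fin d) (f g : MvPolynomial (Fin d) ℂ), f.IsHomogeneous k → g.IsHomogeneous l →
      ‖φ (X i * (f * g))‖ ≤ hardyNorm f * hardyNorm g) (i : Fin d) (q : MvPolynomial (Fin d) ℂ) :
    ‖modelMap.{u} k l φ (X i * q)‖ ≤ ‖modelMap.{u} k l φ q‖ := by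
  rw [← sq_le_sq₀ (norm_nonneg _) (norm_nonneg _), norm_modelMap_sq, norm_modelMap_sq]
  let σ := addLeftEmbedding (Finsupp.single i 1 : Fin d →₀ ℕ)
  have hσ : ∀ m, ((degreeLE d m).filter (·.degree < m)).map σ ⊆ degreeLE d m := by
    intro m α hα
    obtain ⟨β, hβ, rfl⟩ := Finset.mem_map.mp hα
    have h := (Finset.mem_filter.mp hβ).2
    rw [mem_degreeLE, addLeftEmbedding_apply, map_add, Finsupp.degree_single]
    omega
  -- Multiplication by `z_i` shifts coefficients up, so the layer of degree `k` leaves the window.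
  have h1 : ∑ β ∈ degreeLE d k, ‖(X i * q).coeff β‖ ^ 2 =
      ∑ β ∈ degreeLE d k with β.degree < k, ‖q.coeff β‖ ^ 2 := by
    rw [← Finset.sum_subset (hσ k), Finset.sum_map]
    · simp [σ, coeff_X_mul]
    · intro β hβ hβ'
      rw [coeff_X_mul', if_neg, norm_zero, sq, zero_mul]
      intro hi
      refine hβ' (Finset.mem_map.mpr ⟨β - Finsupp.single i 1, ?_, ?_⟩)
      · have h : Finsupp.single i 1 + (β - Finsupp.single i 1) = β :=
          add_tsub_cancel_of_le (Finsupp.single_le_iff.mpr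
            (Nat.one_le_iff_ne_zero.mpr (Finsupp.mem_support_iff.mp hi)))
        have h' := congrArg Finsupp.degree h
        rw [map_add, Finsupp.degree_single] at h'
        rw [mem_degreeLE] at hβ
        rw [Finset.mem_filter, mem_degreeLE]
        omega
      · exact add_tsub_cancel_of_le (Finsupp.single_le_iff.mpr
          (Nat.one_le_iff_ne_zero.mpr (Finsupp.mem_support_iff.mp hi)))
  -- For `|γ| < l`, the product `z^γ z_i` is again an admissible monomial, and distinct `γ` give
  -- distinct ones.
  have h2 : ∑ γ ∈ degreeLE d l with γ.degree < l, ‖φ (monomial γ 1 * (X i * q))‖ ^ 2 ≤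
      ∑ γ ∈ degreeLE d l, ‖φ (monomial γ 1 * q)‖ ^ 2 := by
    refine le_trans (le_of_eq ?_)
      (Finset.sum_le_sum_of_subset_of_nonneg (hσ l) fun _ _ _ => by positivity)
    rw [Finset.sum_map]
    refine Finset.sum_congr rfl fun γ _ => ?_
    rw [addLeftEmbedding_apply, ← mul_assoc, X, monomial_mul, mul_one, add_comm]
  -- The terms with `|γ| = l` are bounded by exactly the coefficient layer lost in `h1`.
  have h3 : ∑ γ ∈ degreeLE d l with ¬ γ.degree < l, ‖φ (monomial γ 1 * (X i * q))‖ ^ 2 ≤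
      ∑ β ∈ degreeLE d k with ¬ β.degree < k, ‖q.coeff β‖ ^ 2 := by
    have hdeg : ∀ {m : ℕ} {α : Fin d →₀ ℕ}, α ∈ degreeLE d m ∧ ¬ α.degree < m ↔ α.degree = m := by
      intro m α
      rw [mem_degreeLE]
      omega
    have h := sum_norm_sq_apply_le i (hφ i) (homogeneousComponent_isHomogeneous k q)
      ((degreeLE d l).filter fun γ => ¬ γ.degree < l) fun γ hγ => hdeg.mp (Finset.mem_filter.mp hγ)
    rw [hardyNorm_sq_eq_sum _ ((degreeLE d k).filter fun β => ¬ β.degree < k) fun β hβ => by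
      rw [Finset.mem_filter, hdeg]
      by_contra hne
      rw [mem_support_iff, coeff_homogeneousComponent, if_neg hne] at hβ
      exact hβ rfl] at h
    refine (le_of_eq ?_).trans (h.trans (le_of_eq ?_))
    · exact Finset.sum_congr rfl fun γ hγ => by
        rw [apply_monomial_mul_X_mul hφn (hdeg.mp (Finset.mem_filter.mp hγ))]
    · exact Finset.sum_congr rfl fun β hβ => by
        rw [coeff_homogeneousComponent, if_pos (hdeg.mp (Finset.mem_filter.mp hβ))]
  rw [h1, ← Finset.sum_filter_add_sum_filter_not (degreeLE d l) (·.degree < l)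
    fun γ => ‖φ (monomial γ 1 * (X i * q))‖ ^ 2,
    ← Finset.sum_filter_add_sum_filter_not (degreeLE d k) (·.degree < k) fun β => ‖q.coeff β‖ ^ 2]
  linarith

/-- Only the constant coefficient survives: `φ(z^γ) = 0` because `|γ| ≤ l < k + l + 1`. -/
theorem norm_modelMap_one {k l : ℕ} {φ : MvPolynomial (Fin d) ℂ →ₗ[ℂ] ℂ}
    (hφn : ∀ q, φ (homogeneousComponent (k + l + 1) q) = φ q) :
    ‖modelMap.{u} k l φ 1‖ = 1 := by
  rw [← sq_eq_sq₀ (norm_nonneg _) zero_le_one, norm_modelMap_sq,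
    Finset.sum_eq_single (0 : Fin d →₀ ℕ), Finset.sum_eq_zero]
  · simp
  · intro γ hγ
    rw [mem_degreeLE] at hγ
    rw [mul_one, ← hφn, homogeneousComponent_of_mem (isHomogeneous_monomial 1 rfl),
      if_neg (by omega)]
    simp
  · intro β _ hβ
    rw [coeff_one, if_neg hβ.symm]
    simp
  · simp [mem_degreeLE]

/-- The value `φ q` is itself the coordinate at `γ = 0`. -/
theorem norm_apply_le_norm_modelMap (k l : ℕ) (φ : MvPolynomial (Fin d) ℂ →ₗ[ℂ] ℂ)
    (q : MvPolynomial (Fin d) ℂ) : ‖φ q‖ ≤ ‖modelMap.{u} k l φ q‖ := by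
  rw [← sq_le_sq₀ (norm_nonneg _) (norm_nonneg _), norm_modelMap_sq]
  have h := Finset.single_le_sum (f := fun γ => ‖φ (monomial γ 1 * q)‖ ^ 2)
    (fun _ _ => by positivity) (mem_degreeLE.mpr (by simp) : (0 : Fin d →₀ ℕ) ∈ degreeLE d l)
  have h0 : (monomial 0 1 : MvPolynomial (Fin d) ℂ) = 1 := rfl
  simp only [h0, one_mul] at h
  exact h.trans (le_add_of_nonneg_left (Finset.sum_nonneg fun _ _ => by positivity))

theorem zWeakProductNorm_le_schurAglerNorm {k l : ℕ} {p : MvPolynomial (Fin d) ℂ}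
    (hp : p.IsHomogeneous (k + l + 1)) : zWeakProductNorm k l p ≤ schurAglerNorm.{u} p := by
  obtain ⟨φ, hφn, hφ, hφp⟩ := exists_dual_zWeakProduct k l p hp
  refine hφp.trans ((norm_apply_le_norm_modelMap.{u} k l φ p).trans ?_)
  have h := norm_apply_le_schurAglerNorm (modelMap.{u} k l φ) (norm_modelMap_X_mul_le hφn hφ) p
  rwa [norm_modelMap_one hφn, mul_one] at h

theorem tripleNormTwo_le_schurAglerNorm {n : ℕ} (hn : n ≠ 0) {p : MvPolynomial (Fin d) ℂ}
    (hp : p.IsHomogeneous n) : tripleNormTwo n hn p ≤ schurAglerNorm.{u} p := by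
  refine Finset.sup'_le _ _ fun k hk => zWeakProductNorm_le_schurAglerNorm ?_
  rw [Finset.mem_range] at hk
  convert hp using 1
  omega

end SchurAgler

theorem mainTheorem3 (d n : ℕ) (hn : n ≠ 0) (p : MvPolynomial (Fin d) ℂ)
    (hp : p.IsHomogeneous n) :
    SchurAgler.schurAglerNorm.{u} p ≥ SchurAgler.tripleNormTwo n hn p ∧
      SchurAgler.tripleNormTwo n hn p ≥ SchurAgler.tripleNormOne n p :=
  ⟨SchurAgler.tripleNormTwo_le_schurAglerNorm hn hp, SchurAgler.tripleNormOne_le_tripleNormTwo hn hp⟩
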